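/- Let $p\ge 11$ be a prime and let $n$ be an integer with $4\le 2n\le p-7$. Let $B_k$ denote the Bernoulli numbers and $\mathfrak{B}_k=B_k/k$ $(k\ge 1)$ the divided Bernoulli numbers. For a $p$-adic integer $x$ with Hensel expansion $x=\sum_{i\ge 0}(x)_i\,p^i$, $(x)_i\in\{0,\dots,p-1\}$, let $(x)_i$ be its digit of index $i$. Let $w_p=\frac{(p-1)!+1}{p}$ be the Wilson quotient, and put $$\mathfrak{D}_i=(\mathfrak{B}_{p-1+i}-\mathfrak{B}_i)_1,\qquad \mathcal{C}\mathfrak{B}(m)=\sum_{i=2}^{m-2}\mathfrak{B}_i\mathfrak{B}_{m-i},\qquad \mathcal{C}\mathfrak{B}\mathfrak{D}(m)=\sum_{i=2}^{m-2}\mathfrak{B}_i\mathfrak{D}_{m-i},$$ $$\mathcal{T}\mathcal{C}\mathfrak{B}\mathfrak{D}(p+1-2n,p-3)=\sum_{i=p+1-2n}^{p-3}\mathfrak{B}_i\,\mathfrak{D}_{2(p-1)-2n-i}.$$ Then $\mathfrak{B}_i$ and $\mathfrak{B}_{p-1+i}-\mathfrak{B}_i$ $(2\le i\le p-3)$, $w_p$,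 and the last fraction below are $p$-adic integers, and $$\begin{aligned}\mathcal{T}\mathcal{C}\mathfrak{B}\mathfrak{D}(p+1-2n,p-3)\equiv{}&-\mathcal{C}\mathfrak{B}\mathfrak{D}(p-1-2n)+w_p\,\big(\mathfrak{B}_{2(p-1)-2n}-\mathfrak{B}_{p-1-2n}\big)_1-\frac12\Big(w_p^2+\mathcal{C}\mathfrak{B}(p-1)\Big)\mathfrak{B}_{p-1-2n}\\&-\frac{pB_{4(p-1)-2n}-3pB_{3(p-1)-2n}+3pB_{2(p-1)-2n}-pB_{p-1-2n}}{2p^3}\pmod{p\mathbb{Z}_p}.\end{aligned}$$ -/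

import Mathlib

open Finset

/-- The digit `(x)_i ∈ {0, …, p - 1}` of index `i` in the Hensel expansion
`x = ∑ (x)_i p ^ i` of a `p`-adic integer `x`. Here `x.appr k` is the representative in
`[0, p ^ k)` of `x` modulo `p ^ k`. -/
noncomputable def henselDigit {p : ℕ} [Fact p.Prime] (x : ℤ_[p]) (i : ℕ) : ℕ :=
  x.appr (i + 1) / p ^ i

theorem henselDigit_lt {p : ℕ} [Fact p.Prime] (x : ℤ_[p]) (i : ℕ) : henselDigit x i < p := by
  have h := x.appr_lt (i + 1)
  rw [pow_succ] at h
  exact Nat.div_lt_of_lt_mul h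

/-- The digits are those of the Hensel expansion: the `k`-th partial sum of
`∑ (x)_i p ^ i` is congruent to `x` modulo `p ^ k`. -/
theorem henselDigit_expansion {p : ℕ} [Fact p.Prime] (x : ℤ_[p]) (k : ℕ) :
    x - ∑ i ∈ range k, (henselDigit x i : ℤ_[p]) * (p : ℤ_[p]) ^ i ∈
      Ideal.span {(p : ℤ_[p]) ^ k} := by
  have key : ∀ k : ℕ, ∑ i ∈ range k, henselDigit x i * p ^ i = x.appr k := by
    intro k
    induction k with
    | zero =>
      have h := x.appr_lt 0
      simp at h
      simp [h]
    | succ k ih =>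
      rw [sum_range_succ, ih, henselDigit]
      obtain ⟨c, hc⟩ := x.dvd_appr_sub_appr k (k + 1) (Nat.le_succ k)
      have hm := x.appr_mono (Nat.le_succ k)
      have hlt := x.appr_lt k
      have hp : 0 < p ^ k := lt_of_le_of_lt (Nat.zero_le _) hlt
      have he : x.appr (k + 1) = x.appr k + p ^ k * c := by
        have : x.appr k ≤ x.appr (k + 1) := hm
        omega
      rw [he, Nat.add_mul_div_left _ _ hp, Nat.div_eq_of_lt hlt, zero_add, mul_comm c]
  have h := PadicInt.appr_spec k x
  rw [← key k] at h
  push_cast at h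
  exact h

/-- A rational number is `p`-integral if it is a `p`-adic integer. -/
def PIntegral (p : ℕ) [Fact p.Prime] (x : ℚ) : Prop :=
  ‖(x : ℚ_[p])‖ ≤ 1

open Classical in
/-- The residue `(x)_i` of a `p`-integral rational number `x`, that is, the digit of index `i`
in its Hensel expansion (and `0` by convention if `x` is not `p`-integral). -/
noncomputable def residue (p : ℕ) [Fact p.Prime] (x : ℚ) (i : ℕ) : ℕ :=
  if h : PIntegral p x then henselDigit (⟨(x : ℚ_[p]), h⟩ : ℤ_[p]) i else 0

/-- Congruence modulo `p` between `p`-integral rational numbers: both are `p`-adic integers and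
their difference lies in `p ℤ_p`. -/
def CongrModP (p : ℕ) [Fact p.Prime] (x y : ℚ) : Prop :=
  PIntegral p x ∧ PIntegral p y ∧ ∃ z : ℤ_[p], ((x - y : ℚ) : ℚ_[p]) = (p : ℚ_[p]) * (z : ℚ_[p])

/-- The divided Bernoulli number `𝔅_k = B_k / k`. -/
def dividedBernoulli (k : ℕ) : ℚ := bernoulli k / (k : ℚ)

/-- The residue `𝔇_i = (𝔅_{p-1+i} - 𝔅_i)_1`. -/
noncomputable def residueD (p : ℕ) [Fact p.Prime] (i : ℕ) : ℕ :=
  residue p (dividedBernoulli (p - 1 + i) - dividedBernoulli i) 1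

/-- The convolution `𝒞𝔅(m) = ∑_{i=2}^{m-2} 𝔅_i 𝔅_{m-i}` of divided Bernoulli numbers. -/
def convB (m : ℕ) : ℚ :=
  ∑ i ∈ Icc 2 (m - 2), dividedBernoulli i * dividedBernoulli (m - i)

/-- The convolution `𝒞𝔅𝔇(m) = ∑_{i=2}^{m-2} 𝔅_i 𝔇_{m-i}`. -/
noncomputable def convBD (p : ℕ) [Fact p.Prime] (m : ℕ) : ℚ :=
  ∑ i ∈ Icc 2 (m - 2), dividedBernoulli i * (residueD p (m - i) : ℚ)

/-- The truncated convolution `𝒯𝒞𝔅𝔇(a, b) = ∑_{i=a}^{b} 𝔅_i 𝔇_{a+b-i}`, of order `a + b`. -/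
noncomputable def truncConvBD (p : ℕ) [Fact p.Prime] (a b : ℕ) : ℚ :=
  ∑ i ∈ Icc a b, dividedBernoulli i * (residueD p (a + b - i) : ℚ)

/-- The Wilson quotient `w_p = ((p - 1)! + 1) / p`. -/
def wilsonQuotient (p : ℕ) : ℚ := ((Nat.factorial (p - 1) : ℚ) + 1) / (p : ℚ)

/-- The combination
`(p B_{4(p-1)-2n} - 3 p B_{3(p-1)-2n} + 3 p B_{2(p-1)-2n} - p B_{p-1-2n}) / (2 p ^ 3)`. -/
def bernoulliCombination (p n : ℕ) : ℚ :=
  ((p : ℚ) * bernoulli (4 * (p - 1) - 2 * n) - 3 * (p : ℚ) * bernoulli (3 * (p - 1) - 2 * n)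
    + 3 * (p : ℚ) * bernoulli (2 * (p - 1) - 2 * n) - (p : ℚ) * bernoulli (p - 1 - 2 * n))
    / (2 * (p : ℚ) ^ 3)

theorem ZMod.two_ne_zero_of_prime {p : ℕ} [Fact p.Prime] (h2 : p ≠ 2) : (2 : ZMod p) ≠ 0 := by
  have h : ((2 : ℕ) : ZMod p) ≠ 0 := fun h =>
    h2 ((Nat.prime_dvd_prime_iff_eq Fact.out Nat.prime_two).mp
      ((ZMod.natCast_eq_zero_iff 2 p).mp h))
  exact_mod_cast h

theorem PadicInt.ringHom_zmod_eq_toZMod {p : ℕ} [Fact p.Prime] (f : ℤ_[p] →+* ZMod p) :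
    f = PadicInt.toZMod := by
  ext x
  have h := PadicInt.toZMod_spec x
  rw [PadicInt.maximalIdeal_eq_span_p, Ideal.mem_span_singleton] at h
  obtain ⟨c, hc⟩ := h
  have hx : x = (((PadicInt.toZMod x).val : ℕ) : ℤ_[p]) + p * c := by
    rw [← hc, ← ZMod.natCast_val]; ring
  have h1 : f x = PadicInt.toZMod x := by
    conv_lhs => rw [hx]
    rw [map_add, map_natCast, map_mul, map_natCast, ZMod.natCast_self, zero_mul, add_zero,
      ZMod.natCast_zmod_val]
  exact h1

/-- The Teichmüller character with values in the `p`-adic integers. -/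
noncomputable def teich (p : ℕ) [Fact p.Prime] : ZMod p →* ℤ_[p] :=
  (WittVector.toPadicInt p : WittVector p (ZMod p) →* ℤ_[p]).comp (WittVector.teichmuller p)

theorem toZMod_teich {p : ℕ} [Fact p.Prime] (a : ZMod p) : PadicInt.toZMod (teich p a) = a := by
  have h := PadicInt.ringHom_zmod_eq_toZMod
    ((WittVector.constantCoeff : WittVector p (ZMod p) →+* ZMod p).comp
      (WittVector.fromPadicInt p))
  rw [← h]
  have h2 := WittVector.fromPadicInt_comp_toPadicInt_ext p (WittVector.teichmuller p a)
  simp only [RingHom.comp_apply, RingHom.id_apply] at h2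
  simp only [teich, RingHom.comp_apply, MonoidHom.comp_apply, MonoidHom.coe_coe, h2]
  exact WittVector.teichmuller_coeff_zero p a

theorem teich_pow_card_sub_one {p : ℕ} [Fact p.Prime] (u : (ZMod p)ˣ) :
    teich p u ^ (p - 1) = 1 := by
  rw [← map_pow, ← Units.val_pow_eq_pow_val, ZMod.units_pow_card_sub_one_eq_one, Units.val_one,
    map_one]

theorem teich_neg_one {p : ℕ} [Fact p.Prime] (h2 : p ≠ 2) : teich p (-1) = -1 := by
  have h : teich p (-1) ^ 2 = 1 := by rw [← map_pow]; simp
  rcases mul_self_eq_one_iff.mp ((sq _).symm.trans h) with h | h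
  · exfalso
    have h1 := toZMod_teich (-1 : ZMod p)
    rw [h, map_one] at h1
    have : Fact (2 < p) := ⟨lt_of_le_of_ne (Fact.out : p.Prime).two_le (Ne.symm h2)⟩
    exact ZMod.neg_one_ne_one h1.symm
  · exact h

theorem dvd_of_toZMod_eq_zero {p : ℕ} [Fact p.Prime] {x : ℤ_[p]} (h : PadicInt.toZMod x = 0) :
    (p : ℤ_[p]) ∣ x := by
  rw [← RingHom.mem_ker, PadicInt.ker_toZMod, PadicInt.maximalIdeal_eq_span_p,
    Ideal.mem_span_singleton] at h
  exact h

theorem exists_eq_teich_mul {p : ℕ} [Fact p.Prime] (u : (ZMod p)ˣ) :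
    ∃ v : ℤ_[p], (((u : ZMod p).val : ℕ) : ℤ_[p]) = teich p u * (1 + p * v) := by
  have h : PadicInt.toZMod ((((u : ZMod p).val : ℕ) : ℤ_[p]) * teich p (u⁻¹ : (ZMod p)ˣ) - 1)
      = 0 := by
    rw [map_sub, map_mul, map_natCast, ZMod.natCast_zmod_val, toZMod_teich, map_one,
      Units.mul_inv, sub_self]
  obtain ⟨c, hc⟩ := dvd_of_toZMod_eq_zero h
  refine ⟨c, ?_⟩
  rw [← hc]
  have h1 : teich p u * teich p (u⁻¹ : (ZMod p)ˣ) = 1 := by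
    rw [← map_mul, Units.mul_inv, map_one]
  linear_combination (-(((u : ZMod p).val : ℕ) : ℤ_[p])) * h1

/-- The `p`-adic integer `v` with `a = ω(a) (1 + p v)`, where `a` is the least positive residue
of `u` and `ω` the Teichmüller character. -/
noncomputable def teichQuot {p : ℕ} [Fact p.Prime] (u : (ZMod p)ˣ) : ℤ_[p] :=
  (exists_eq_teich_mul u).choose

theorem val_eq_teich_mul {p : ℕ} [Fact p.Prime] (u : (ZMod p)ˣ) :
    (((u : ZMod p).val : ℕ) : ℤ_[p]) = teich p u * (1 + p * teichQuot u) :=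
  (exists_eq_teich_mul u).choose_spec

theorem teichQuot_neg {p : ℕ} [Fact p.Prime] (h2 : p ≠ 2) (u : (ZMod p)ˣ) :
    teichQuot (-u) = teichQuot u - teich p (u⁻¹ : (ZMod p)ˣ) := by
  have h := val_eq_teich_mul (-u)
  have h' := val_eq_teich_mul u
  have h1 : teich p u * teich p (u⁻¹ : (ZMod p)ˣ) = 1 := by
    rw [← map_mul, Units.mul_inv, map_one]
  have hneg : teich p ((-u : (ZMod p)ˣ) : ZMod p) = - teich p u := by
    rw [Units.val_neg, neg_eq_neg_one_mul, map_mul, teich_neg_one h2, neg_one_mul]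
  have : NeZero (u : ZMod p) := ⟨u.ne_zero⟩
  have hval : (((-u : (ZMod p)ˣ) : ZMod p).val : ℤ_[p]) = p - ((u : ZMod p).val : ℤ_[p]) := by
    rw [Units.val_neg, ZMod.val_neg_of_ne_zero, Nat.cast_sub (ZMod.val_lt _).le]
  have hp0 : (p : ℤ_[p]) ≠ 0 := by exact_mod_cast (Fact.out : p.Prime).ne_zero
  have hu0 : teich p u ≠ 0 := left_ne_zero_of_mul_eq_one h1
  rw [hval, hneg, h'] at h
  apply mul_left_cancel₀ (mul_ne_zero hu0 hp0)
  linear_combination h + p * h1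

/-- The sum of `ω(u) ^ k v(u) ^ r` over the units modulo `p`. -/
noncomputable def twistedSum (p : ℕ) [Fact p.Prime] (r k : ℕ) : ℤ_[p] :=
  ∑ u : (ZMod p)ˣ, teich p u ^ k * teichQuot u ^ r

/-- The reduction modulo `p` of `twistedSum`. -/
noncomputable def twistedSumMod (p : ℕ) [Fact p.Prime] (r k : ℕ) : ZMod p :=
  ∑ u : (ZMod p)ˣ, (u : ZMod p) ^ k * PadicInt.toZMod (teichQuot u) ^ r

theorem toZMod_twistedSum (p : ℕ) [Fact p.Prime] (r k : ℕ) :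
    PadicInt.toZMod (twistedSum p r k) = twistedSumMod p r k := by
  simp [twistedSum, twistedSumMod, toZMod_teich]

theorem twistedSum_add_card (p : ℕ) [Fact p.Prime] (r k t : ℕ) :
    twistedSum p r (k + t * (p - 1)) = twistedSum p r k := by
  simp only [twistedSum, pow_add, mul_comm t, pow_mul, teich_pow_card_sub_one, one_pow, mul_one]

theorem twistedSumMod_add_card (p : ℕ) [Fact p.Prime] (r k : ℕ) :
    twistedSumMod p r (k + (p - 1)) = twistedSumMod p r k := by
  rw [← toZMod_twistedSum, ← toZMod_twistedSum, ← twistedSum_add_card p r k 1, one_mul]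

theorem twistedSum_zero_left (p : ℕ) [Fact p.Prime] {k : ℕ} (hk : ¬ p - 1 ∣ k) :
    twistedSum p 0 k = 0 := by
  have h := FiniteField.forall_pow_eq_one_iff (ZMod p) k
  rw [ZMod.card] at h
  rw [← h] at hk
  push Not at hk
  obtain ⟨g, hg⟩ := hk
  have h1 : twistedSum p 0 k = teich p g ^ k * twistedSum p 0 k := by
    simp only [twistedSum, pow_zero, mul_one, mul_sum]
    rw [← Equiv.sum_comp (Equiv.mulLeft g)]
    refine sum_congr rfl fun u _ => ?_
    simp [mul_pow]
  have h2 : teich p g ^ k ≠ 1 := by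
    intro h2
    apply hg
    have h3 := congrArg PadicInt.toZMod h2
    rw [map_pow, toZMod_teich, map_one] at h3
    exact Units.ext (by simpa using h3)
  have h3 : (teich p g ^ k - 1) * twistedSum p 0 k = 0 := by linear_combination -h1
  exact (mul_eq_zero.mp h3).resolve_left (sub_ne_zero.mpr h2)

theorem twistedSumMod_zero_left (p : ℕ) [Fact p.Prime] {k : ℕ} (hk : ¬ p - 1 ∣ k) :
    twistedSumMod p 0 k = 0 := by
  rw [← toZMod_twistedSum, twistedSum_zero_left p hk, map_zero]

theorem twistedSumMod_zero_zero (p : ℕ) [Fact p.Prime] : twistedSumMod p 0 0 = -1 := by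
  simp [twistedSumMod, ZMod.card_units_eq_totient, Nat.totient_prime (Fact.out : p.Prime),
    Nat.cast_sub (Fact.out : p.Prime).one_le]

theorem exists_one_add_pow_eq {R : Type*} [CommRing R] (x : R) (k : ℕ) :
    ∃ c, (1 + x) ^ k = 1 + k * x + k.choose 2 * x ^ 2 + k.choose 3 * x ^ 3 + x ^ 4 * c := by
  induction k with
  | zero => exact ⟨0, by simp⟩
  | succ k ih =>
    obtain ⟨c, hc⟩ := ih
    refine ⟨c * (1 + x) + k.choose 3, ?_⟩
    rw [pow_succ, hc, Nat.choose_succ_succ' k 1, Nat.choose_succ_succ' k 2, Nat.choose_one_right]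
    push_cast
    ring

@[to_additive]
theorem prod_zmod_val_eq {p : ℕ} [Fact p.Prime] {M : Type*} [CommMonoid M] (f : ℕ → M) :
    ∏ u : (ZMod p)ˣ, f (u : ZMod p).val = ∏ a ∈ Ico 1 p, f a := by
  refine prod_bij (fun u _ => (u : ZMod p).val) ?_ ?_ ?_ ?_
  · intro u _
    rw [mem_Ico]
    exact ⟨Nat.one_le_iff_ne_zero.mpr (by simp [ZMod.val_eq_zero]), ZMod.val_lt _⟩
  · intro u _ w _ h
    exact Units.ext (ZMod.val_injective p h)
  · intro a ha
    rw [mem_Ico] at ha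
    have h0 : (a : ZMod p) ≠ 0 := by
      rw [Ne, ZMod.natCast_eq_zero_iff]
      exact Nat.not_dvd_of_pos_of_lt ha.1 ha.2
    exact ⟨Units.mk0 _ h0, mem_univ _, by simp [ZMod.val_natCast, Nat.mod_eq_of_lt ha.2]⟩
  · intro u _
    rfl

theorem exists_sum_range_pow_eq_twistedSum {p : ℕ} [Fact p.Prime] {k : ℕ} (hk : ¬ p - 1 ∣ k) :
    ∃ c : ℤ_[p], ∑ a ∈ range p, (a : ℤ_[p]) ^ k =
      p * k * twistedSum p 1 k + p ^ 2 * k.choose 2 * twistedSum p 2 k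
        + p ^ 3 * k.choose 3 * twistedSum p 3 k + p ^ 4 * c := by
  have hk0 : k ≠ 0 := by rintro rfl; simp at hk
  have hp : 0 < p := (Fact.out : p.Prime).pos
  choose c hc using fun u : (ZMod p)ˣ => exists_one_add_pow_eq ((p : ℤ_[p]) * teichQuot u) k
  refine ⟨∑ u : (ZMod p)ˣ, teich p u ^ k * teichQuot u ^ 4 * c u, ?_⟩
  have h0 := twistedSum_zero_left p hk
  rw [range_eq_Ico, sum_eq_sum_Ico_succ_bot hp, Nat.cast_zero, zero_pow hk0, zero_add, zero_add,
    ← sum_zmod_val_eq (fun a => (a : ℤ_[p]) ^ k)]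
  rw [← zero_add (∑ u : (ZMod p)ˣ, _), ← sub_self (twistedSum p 0 k)]
  nth_rewrite 1 [h0]
  simp only [twistedSum, mul_sum, val_eq_teich_mul, mul_pow, hc, ← sum_add_distrib, zero_sub,
    ← sum_neg_distrib]
  refine sum_congr rfl fun u _ => ?_
  ring

theorem pIntegral_iff_mem {p : ℕ} [Fact p.Prime] {x : ℚ} :
    PIntegral p x ↔ x ∈ (PadicInt.subring p).comap (Rat.castHom ℚ_[p]) :=
  Iff.rfl

theorem pIntegral_iff_exists {p : ℕ} [Fact p.Prime] {x : ℚ} :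
    PIntegral p x ↔ ∃ z : ℤ_[p], (z : ℚ_[p]) = x :=
  ⟨fun h => ⟨⟨_, h⟩, rfl⟩, fun ⟨z, hz⟩ => by unfold PIntegral; rw [← hz]; exact z.2⟩

theorem exists_coe_eq_inv {p : ℕ} [Fact p.Prime] {m : ℕ} (hm : ¬ p ∣ m) :
    ∃ d : ℤ_[p], (d : ℚ_[p]) = (m : ℚ_[p])⁻¹ := by
  have h : ‖(m : ℚ_[p])‖ = 1 :=
    Padic.norm_natCast_eq_one_iff.mpr ((Nat.Prime.coprime_iff_not_dvd Fact.out).mpr hm)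
  exact ⟨⟨(m : ℚ_[p])⁻¹, by rw [norm_inv, h, inv_one]⟩, rfl⟩

theorem pIntegral_inv_natCast {p : ℕ} [Fact p.Prime] {m : ℕ} (hm : ¬ p ∣ m) :
    PIntegral p (m : ℚ)⁻¹ := by
  obtain ⟨d, hd⟩ := exists_coe_eq_inv hm
  exact pIntegral_iff_exists.mpr ⟨d, by rw [hd]; push_cast; rfl⟩

theorem pow_prime_div_succ_eq {p : ℕ} [Fact p.Prime] (hp : 7 ≤ p) {r : ℕ} (hr : 4 ≤ r) :
    ∃ c : ℤ_[p], (p : ℚ_[p]) ^ r = (r + 1) * p ^ 4 * c := by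
  have hpr : p.Prime := Fact.out
  obtain ⟨e, m, hm, hrm⟩ := Nat.exists_eq_pow_mul_and_not_dvd (Nat.succ_ne_zero r) p hpr.ne_one
  have hm0 : 0 < m := Nat.pos_of_ne_zero fun h => hm (h ▸ dvd_zero p)
  have hle : e + 4 ≤ r := by
    rcases Nat.eq_zero_or_pos e with rfl | he
    · simpa using hr
    · have h1 : 1 + e * 6 ≤ p ^ e := by
        calc 1 + e * 6 ≤ (1 + 6) ^ e := by
              have := one_add_mul_le_pow (show (-2 : ℤ) ≤ 6 by norm_num) e
              exact_mod_cast this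
          _ ≤ p ^ e := Nat.pow_le_pow_left hp e
      have h2 : p ^ e ≤ r + 1 := by
        rw [← Nat.succ_eq_add_one, hrm]
        exact Nat.le_mul_of_pos_right _ hm0
      omega
  obtain ⟨d, hd⟩ := exists_coe_eq_inv hm
  refine ⟨p ^ (r - e - 4) * d, ?_⟩
  have hm0' : (m : ℚ_[p]) ≠ 0 := by exact_mod_cast hm0.ne'
  have hd' : (m : ℚ_[p]) * d = 1 := by rw [hd, mul_inv_cancel₀ hm0']
  have hr' : ((r : ℚ_[p]) + 1) = p ^ e * m := by exact_mod_cast hrm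
  rw [hr']
  push_cast
  calc (p : ℚ_[p]) ^ r = p ^ (e + 4 + (r - e - 4)) := by congr 1; omega
    _ = _ := by
      rw [pow_add, pow_add]
      linear_combination (-(p : ℚ_[p]) ^ e * p ^ 4 * p ^ (r - e - 4)) * hd'

theorem pIntegral_prime_mul_bernoulli {p : ℕ} [Fact p.Prime] (h2 : p ≠ 2) (k : ℕ) :
    PIntegral p (p * bernoulli k) := by
  have hpr : p.Prime := Fact.out
  rw [pIntegral_iff_mem]
  rcases Nat.even_or_odd' k with ⟨l, rfl | rfl⟩
  · obtain ⟨z, hz⟩ := Bernoulli.vonStaudt_clausen l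
    rw [← sub_eq_iff_eq_add] at hz
    rw [← hz, mul_sub, mul_sum]
    refine sub_mem (mul_mem (natCast_mem _ _) (intCast_mem _ _)) (sum_mem fun q hq => ?_)
    have hq' : q.Prime := (mem_filter.mp hq).2.1
    by_cases hqp : p = q
    · subst hqp
      rw [mul_one_div_cancel (by exact_mod_cast hpr.ne_zero)]
      exact one_mem _
    · rw [one_div]
      exact mul_mem (natCast_mem _ _) (pIntegral_inv_natCast
        fun h => hqp ((Nat.prime_dvd_prime_iff_eq hpr hq').mp h))
  · rcases Nat.eq_zero_or_pos l with rfl | hl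
    · have h : (p : ℚ) * bernoulli (2 * 0 + 1) = -(p * ((2 : ℕ) : ℚ)⁻¹) := by
        simp [bernoulli_one]; ring
      rw [h]
      exact neg_mem (mul_mem (natCast_mem _ _) (pIntegral_inv_natCast
        fun h => h2 ((Nat.prime_dvd_prime_iff_eq hpr Nat.prime_two).mp h)))
    · rw [bernoulli_eq_zero_of_odd ⟨l, rfl⟩ (by omega), mul_zero]
      exact zero_mem _

theorem exists_coe_eq_prime_mul_bernoulli {p : ℕ} [Fact p.Prime] (h2 : p ≠ 2) (k : ℕ) :
    ∃ b : ℤ_[p], (b : ℚ_[p]) = p * (bernoulli k : ℚ_[p]) :=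
  ⟨⟨_, pIntegral_prime_mul_bernoulli h2 k⟩, by push_cast; rfl⟩

theorem sum_range_pow_eq_choose (n k : ℕ) :
    ∑ a ∈ range n, (a : ℚ) ^ k =
      ∑ r ∈ range (k + 1), bernoulli (k - r) * k.choose r * n ^ (r + 1) / (r + 1) := by
  rw [sum_range_pow, ← sum_range_reflect]
  refine sum_congr rfl fun r hr => ?_
  have hr' : r ≤ k := Nat.lt_succ_iff.mp (mem_range.mp hr)
  have h1 : k + 1 - 1 - r = k - r := by omega
  have h2 : k + 1 - (k - r) = r + 1 := by omega
  have h3 : (k + 1).choose (k - r) = (k + 1).choose (r + 1) := by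
    rw [← Nat.choose_symm (by omega : r + 1 ≤ k + 1)]; congr 1; omega
  have h4 : ((k : ℚ) + 1) * k.choose r = (k + 1).choose (r + 1) * (r + 1) := by
    exact_mod_cast Nat.add_one_mul_choose_eq k r
  rw [h1, h2, h3]
  field_simp
  linear_combination (-bernoulli (k - r) * n ^ (r + 1)) * h4

/-- The sum of `k`-th powers modulo `p ^ 4`. -/
theorem exists_sum_range_pow_eq_bernoulli {p : ℕ} [Fact p.Prime] (hp : 7 ≤ p) {k : ℕ}
    (hk : Even k) (hk0 : k ≠ 0) :
    ∃ c : ℤ_[p], ∑ a ∈ range p, (a : ℚ_[p]) ^ k =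
      p * (bernoulli k : ℚ_[p]) - (if k = 2 then (p : ℚ_[p]) ^ 2 / 2 else 0)
        + p ^ 3 * k.choose 2 * (bernoulli (k - 2) : ℚ_[p]) / 3 + p ^ 4 * c := by
  have h := congrArg (fun x : ℚ => (x : ℚ_[p])) (sum_range_pow_eq_choose p k)
  simp only [Rat.cast_sum, Rat.cast_pow, Rat.cast_natCast, Rat.cast_div, Rat.cast_mul,
    Rat.cast_add, Rat.cast_one] at h
  rw [h]
  have hp2 : ¬ p ∣ 2 := Nat.not_dvd_of_pos_of_lt (by norm_num) (by omega)
  by_cases hk2 : k = 2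
  · subst hk2
    refine ⟨0, ?_⟩
    simp [sum_range_succ, bernoulli_one, bernoulli_zero]
    ring
  · obtain ⟨m, rfl⟩ : ∃ m, k = m + 4 := by
      obtain ⟨l, rfl⟩ := hk
      exact ⟨l + l - 4, by omega⟩
    have hterm : ∀ r ∈ range (m + 1), ∃ c : ℤ_[p],
        (bernoulli (m + 4 - (r + 4)) : ℚ_[p]) * ((m + 4).choose (r + 4) : ℕ)
          * (p : ℚ_[p]) ^ (r + 4 + 1) / (((r + 4 : ℕ) : ℚ_[p]) + 1) = p ^ 4 * c := by
      intro r _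
      obtain ⟨c, hc⟩ := pow_prime_div_succ_eq (p := p) hp (r := r + 4) (by omega)
      obtain ⟨b, hb⟩ := exists_coe_eq_prime_mul_bernoulli (p := p) (by omega) (m + 4 - (r + 4))
      refine ⟨b * (m + 4).choose (r + 4) * c, ?_⟩
      have h0 : (((r + 4 : ℕ) : ℚ_[p]) + 1) ≠ 0 := by exact_mod_cast Nat.succ_ne_zero (r + 4)
      rw [div_eq_iff h0, pow_succ, hc]
      push_cast
      rw [hb]
      push_cast
      ring
    choose! c hc using hterm
    obtain ⟨d, hd⟩ : ∃ d : ℤ_[p], (bernoulli (m + 1) : ℚ_[p]) * (m + 4).choose 3 / 4 = d := by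
      rcases Nat.eq_zero_or_pos m with rfl | hm
      · obtain ⟨d, hd⟩ := exists_coe_eq_inv hp2
        refine ⟨-d, ?_⟩
        push_cast [bernoulli_one, hd, show Nat.choose (0 + 4) 3 = 4 by rfl]
        ring
      · refine ⟨0, ?_⟩
        rw [bernoulli_eq_zero_of_odd ?_ (by omega)]
        · simp
        · obtain ⟨l, hl⟩ := hk
          exact ⟨l - 2, by omega⟩
    have h3 : bernoulli (m + 3) = 0 := by
      refine bernoulli_eq_zero_of_odd ?_ (by omega)
      obtain ⟨l, hl⟩ := hk
      exact ⟨l - 1, by omega⟩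
    refine ⟨∑ r ∈ range (m + 1), c r + d, ?_⟩
    rw [sum_range_succ', sum_range_succ', sum_range_succ', sum_range_succ', sum_congr rfl hc,
      if_neg hk2]
    have e1 : m + 4 - (0 + 1) = m + 3 := by omega
    have e2 : m + 4 - (0 + 1 + 1) = m + 2 := by omega
    have e3 : m + 4 - (0 + 1 + 1 + 1) = m + 1 := by omega
    simp only [e1, e2, e3, h3, Nat.sub_zero, Nat.choose_zero_right]
    rw [← mul_sum]
    push_cast [← hd, PadicInt.coe_sum]
    ring

/-- `x` is a `p`-integral rational number with reduction `c` modulo `p`. -/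
def HasReduction (p : ℕ) [Fact p.Prime] (x : ℚ) (c : ZMod p) : Prop :=
  ∃ z : ℤ_[p], (z : ℚ_[p]) = x ∧ PadicInt.toZMod z = c

namespace HasReduction

variable {p : ℕ} [Fact p.Prime] {x y : ℚ} {c d : ZMod p}

theorem pIntegral (h : HasReduction p x c) : PIntegral p x :=
  pIntegral_iff_exists.mpr (h.imp fun _ hz => hz.1)

theorem add (hx : HasReduction p x c) (hy : HasReduction p y d) :
    HasReduction p (x + y) (c + d) := by
  obtain ⟨a, ha, rfl⟩ := hx
  obtain ⟨b, hb, rfl⟩ := hy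
  exact ⟨a + b, by push_cast [ha, hb]; rfl, map_add _ _ _⟩

theorem mul (hx : HasReduction p x c) (hy : HasReduction p y d) :
    HasReduction p (x * y) (c * d) := by
  obtain ⟨a, ha, rfl⟩ := hx
  obtain ⟨b, hb, rfl⟩ := hy
  exact ⟨a * b, by push_cast [ha, hb]; rfl, map_mul _ _ _⟩

theorem neg (hx : HasReduction p x c) : HasReduction p (-x) (-c) := by
  obtain ⟨a, ha, rfl⟩ := hx
  exact ⟨-a, by push_cast [ha]; rfl, map_neg _ _⟩

theorem sub (hx : HasReduction p x c) (hy : HasReduction p y d) :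
    HasReduction p (x - y) (c - d) := by
  rw [sub_eq_add_neg, sub_eq_add_neg]
  exact hx.add hy.neg

theorem natCast (m : ℕ) : HasReduction p m m :=
  ⟨m, by push_cast; rfl, map_natCast _ _⟩

theorem inv_natCast {m : ℕ} (hm : ¬ p ∣ m) : HasReduction p (m : ℚ)⁻¹ (m : ZMod p)⁻¹ := by
  obtain ⟨d, hd⟩ := exists_coe_eq_inv hm
  refine ⟨d, by rw [hd]; push_cast; rfl, ?_⟩
  have hm0 : (m : ZMod p) ≠ 0 := fun h => hm ((ZMod.natCast_eq_zero_iff m p).mp h)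
  have hm0' : (m : ℚ_[p]) ≠ 0 := by
    rintro h
    exact hm (by rw [Nat.cast_eq_zero.mp h]; exact dvd_zero p)
  have h1 : d * m = 1 := by
    apply PadicInt.ext
    push_cast
    rw [hd, inv_mul_cancel₀ hm0']
  apply eq_inv_of_mul_eq_one_left
  rw [← map_natCast (PadicInt.toZMod : ℤ_[p] →+* ZMod p), ← map_mul, h1, map_one]

theorem sum {ι : Type*} {s : Finset ι} {f : ι → ℚ} {g : ι → ZMod p}
    (h : ∀ i ∈ s, HasReduction p (f i) (g i)) :
    HasReduction p (∑ i ∈ s, f i) (∑ i ∈ s, g i) := by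
  classical
  induction s using Finset.induction_on with
  | empty => simpa using natCast (p := p) 0
  | insert a s ha ih =>
    rw [sum_insert ha, sum_insert ha]
    exact (h a (mem_insert_self a s)).add (ih fun i hi => h i (mem_insert_of_mem hi))

theorem congrModP (hx : HasReduction p x c) (hy : HasReduction p y c) : CongrModP p x y := by
  refine ⟨hx.pIntegral, hy.pIntegral, ?_⟩
  obtain ⟨a, ha, ha'⟩ := hx
  obtain ⟨b, hb, hb'⟩ := hy
  obtain ⟨z, hz⟩ := dvd_of_toZMod_eq_zero (x := a - b) (by rw [map_sub, ha', hb', sub_self])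
  refine ⟨z, ?_⟩
  push_cast
  rw [← ha, ← hb]
  exact_mod_cast congrArg (fun t : ℤ_[p] => (t : ℚ_[p])) hz

end HasReduction

theorem hasReduction_residue_one {p : ℕ} [Fact p.Prime] {x : ℚ} {z : ℤ_[p]}
    (h : (x : ℚ_[p]) = p * z) : HasReduction p (residue p x 1 : ℚ) (PadicInt.toZMod z) := by
  have hx : PIntegral p x := pIntegral_iff_exists.mpr ⟨p * z, by rw [h]; push_cast; rfl⟩
  have hX : (⟨(x : ℚ_[p]), hx⟩ : ℤ_[p]) = (p : ℤ_[p]) * z :=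
    Subtype.ext (by push_cast; exact h)
  have hp0 : (p : ℤ_[p]) ≠ 0 := by exact_mod_cast (Fact.out : p.Prime).ne_zero
  rw [residue, dif_pos hx, hX]
  have h2 := henselDigit_expansion ((p : ℤ_[p]) * z) 2
  rw [Ideal.mem_span_singleton, sum_range_succ, sum_range_one, pow_zero, mul_one, pow_one] at h2
  obtain ⟨c, hc⟩ := h2
  have h0 : henselDigit ((p : ℤ_[p]) * z) 0 = 0 := by
    have h3 := congrArg PadicInt.toZMod hc
    simp only [map_sub, map_add, map_mul, map_natCast, ZMod.natCast_self, map_pow] at h3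
    have h4 : ((henselDigit ((p : ℤ_[p]) * z) 0 : ℕ) : ZMod p) = 0 := by linear_combination -h3
    exact Nat.eq_zero_of_dvd_of_lt ((ZMod.natCast_eq_zero_iff _ _).mp h4) (henselDigit_lt _ _)
  rw [h0] at hc
  have h5 : z - (henselDigit ((p : ℤ_[p]) * z) 1 : ℤ_[p]) = p * c := by
    apply mul_left_cancel₀ hp0
    push_cast at hc
    linear_combination hc
  have h6 := congrArg PadicInt.toZMod h5
  simp only [map_sub, map_mul, map_natCast, ZMod.natCast_self, zero_mul, sub_eq_zero] at h6
  rw [h6]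
  exact HasReduction.natCast _

theorem exists_bernoulli_eq_twistedSum {p : ℕ} [Fact p.Prime] (hp : 7 ≤ p) {k : ℕ}
    (hk : Even k) (hpk : ¬ p - 1 ∣ k) :
    ∃ c : ℤ_[p], p * (bernoulli k : ℚ_[p]) - (if k = 2 then (p : ℚ_[p]) ^ 2 / 2 else 0)
        + p ^ 3 * k.choose 2 * (bernoulli (k - 2) : ℚ_[p]) / 3 =
      p * k * twistedSum p 1 k + p ^ 2 * k.choose 2 * twistedSum p 2 k
        + p ^ 3 * k.choose 3 * twistedSum p 3 k + p ^ 4 * c := by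
  have hk0 : k ≠ 0 := by rintro rfl; simp at hpk
  obtain ⟨c, hc⟩ := exists_sum_range_pow_eq_twistedSum hpk
  obtain ⟨d, hd⟩ := exists_sum_range_pow_eq_bernoulli hp hk hk0
  have hc' := congrArg (fun t : ℤ_[p] => (t : ℚ_[p])) hc
  push_cast [PadicInt.coe_sum] at hc'
  refine ⟨c - d, ?_⟩
  push_cast
  linear_combination hc' - hd

theorem exists_bernoulli_eq_mod_prime {p : ℕ} [Fact p.Prime] (hp : 7 ≤ p) {k : ℕ}
    (hk : Even k) (hpk : ¬ p - 1 ∣ k) :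
    ∃ c : ℤ_[p], (bernoulli k : ℚ_[p]) = k * twistedSum p 1 k + p * c := by
  obtain ⟨c, hc⟩ := exists_bernoulli_eq_twistedSum hp hk hpk
  obtain ⟨b, hb⟩ := exists_coe_eq_prime_mul_bernoulli (p := p) (by omega) (k - 2)
  obtain ⟨d2, hd2⟩ := exists_coe_eq_inv (p := p) (m := 2)
    (Nat.not_dvd_of_pos_of_lt (by norm_num) (by omega))
  obtain ⟨d3, hd3⟩ := exists_coe_eq_inv (p := p) (m := 3)
    (Nat.not_dvd_of_pos_of_lt (by norm_num) (by omega))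
  have hp0 : (p : ℚ_[p]) ≠ 0 := by exact_mod_cast (Fact.out : p.Prime).ne_zero
  refine ⟨(if k = 2 then d2 else 0) + k.choose 2 * twistedSum p 2 k
    + p * k.choose 3 * twistedSum p 3 k + p ^ 2 * c - k.choose 2 * b * d3, ?_⟩
  apply mul_left_cancel₀ hp0
  push_cast at hd2 hd3
  have hif : (((if k = 2 then d2 else 0 : ℤ_[p]) : ℤ_[p]) : ℚ_[p]) * p ^ 2
      = if k = 2 then (p : ℚ_[p]) ^ 2 / 2 else 0 := by
    split_ifs
    · rw [hd2]; ring
    · simp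
  push_cast [hb, hd3]
  linear_combination hc - hif

theorem exists_bernoulli_eq_mod_prime_sq {p : ℕ} [Fact p.Prime] (hp : 7 ≤ p) {k : ℕ}
    (hk : Even k) (hpk : ¬ p - 1 ∣ k)
    (hz : ∃ z : ℤ_[p], (k.choose 2 : ℚ_[p]) * (bernoulli (k - 2) : ℚ_[p]) = z) :
    ∃ c : ℤ_[p], (bernoulli k : ℚ_[p]) =
      k * twistedSum p 1 k + p * k.choose 2 * twistedSum p 2 k
        + (if k = 2 then (p : ℚ_[p]) / 2 else 0) + p ^ 2 * c := by
  obtain ⟨c, hc⟩ := exists_bernoulli_eq_twistedSum hp hk hpk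
  obtain ⟨z, hz⟩ := hz
  obtain ⟨d3, hd3⟩ := exists_coe_eq_inv (p := p) (m := 3)
    (Nat.not_dvd_of_pos_of_lt (by norm_num) (by omega))
  have hp0 : (p : ℚ_[p]) ≠ 0 := by exact_mod_cast (Fact.out : p.Prime).ne_zero
  refine ⟨k.choose 3 * twistedSum p 3 k + p * c - z * d3, ?_⟩
  apply mul_left_cancel₀ hp0
  push_cast at hd3
  push_cast [← hz, hd3]
  have hif : (p : ℚ_[p]) * (if k = 2 then (p : ℚ_[p]) / 2 else 0)
      = if k = 2 then (p : ℚ_[p]) ^ 2 / 2 else 0 := by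
    split_ifs
    · ring
    · simp
  linear_combination hc - hif

theorem hasReduction_dividedBernoulli {p : ℕ} [Fact p.Prime] (hp : 7 ≤ p) {k : ℕ}
    (hk : Even k) (hpk : ¬ p - 1 ∣ k) (hpk' : ¬ p ∣ k) :
    HasReduction p (dividedBernoulli k) (twistedSumMod p 1 k) := by
  obtain ⟨c, hc⟩ := exists_bernoulli_eq_mod_prime hp hk hpk
  obtain ⟨d, hd⟩ := exists_coe_eq_inv hpk'
  have hk0 : (k : ℚ_[p]) ≠ 0 := by
    rintro h
    exact hpk' (by rw [Nat.cast_eq_zero.mp h]; exact dvd_zero p)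
  refine ⟨twistedSum p 1 k + p * c * d, ?_, ?_⟩
  · rw [dividedBernoulli]
    push_cast [hc, hd]
    field_simp
  · simp [toZMod_twistedSum]

theorem exists_dividedBernoulli_eq_mod_prime_sq {p : ℕ} [Fact p.Prime] (hp : 7 ≤ p) {k : ℕ}
    (hk : Even k) (hpk : ¬ p - 1 ∣ k) (hpk' : ¬ p ∣ k)
    (hz : ∃ z : ℤ_[p], (k.choose 2 : ℚ_[p]) * (bernoulli (k - 2) : ℚ_[p]) = z) :
    ∃ c : ℤ_[p], (dividedBernoulli k : ℚ_[p]) =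
      twistedSum p 1 k + p * ((k - 1) / 2 * twistedSum p 2 k)
        + p * (if k = 2 then 1 / 4 else 0) + p ^ 2 * c := by
  obtain ⟨c, hc⟩ := exists_bernoulli_eq_mod_prime_sq hp hk hpk hz
  obtain ⟨d, hd⟩ := exists_coe_eq_inv hpk'
  have hk0 : (k : ℚ_[p]) ≠ 0 := by
    rintro h
    exact hpk' (by rw [Nat.cast_eq_zero.mp h]; exact dvd_zero p)
  refine ⟨c * d, ?_⟩
  rw [dividedBernoulli]
  push_cast [hc, hd, Nat.cast_choose_two]
  split_ifs with h2
  · subst h2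
    push_cast
    field_simp
    ring
  · field_simp
    ring

theorem exists_dividedBernoulli_sub_eq {p : ℕ} [Fact p.Prime] (hp : 7 ≤ p) {j : ℕ}
    (hj : Even j) (hj2 : 2 ≤ j) (hjp : j ≤ p - 3) :
    ∃ z : ℤ_[p], ((dividedBernoulli (p - 1 + j) - dividedBernoulli j : ℚ) : ℚ_[p]) = p * z ∧
      PadicInt.toZMod z = -twistedSumMod p 2 j / 2 - if j = 2 then 1 / 4 else 0 := by
  have hpr : p.Prime := Fact.out
  have hodd : Even (p - 1) := hpr.even_sub_one (by omega)
  have hnd : ∀ i, 0 < i → i < p - 1 → ¬ p - 1 ∣ i := fun i => Nat.not_dvd_of_pos_of_lt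
  have hz1 : ∃ z : ℤ_[p], (j.choose 2 : ℚ_[p]) * (bernoulli (j - 2) : ℚ_[p]) = z := by
    rcases hj2.eq_or_lt with rfl | hj2
    · exact ⟨1, by simp⟩
    · obtain ⟨c, hc⟩ := exists_bernoulli_eq_mod_prime hp (k := j - 2)
        (hj.tsub even_two) (hnd _ (by omega) (by omega))
      exact ⟨j.choose 2 * ((j - 2 : ℕ) * twistedSum p 1 (j - 2) + p * c), by
        rw [hc]; push_cast; rfl⟩
  have hz2 : ∃ z : ℤ_[p],
      ((p - 1 + j).choose 2 : ℚ_[p]) * (bernoulli (p - 1 + j - 2) : ℚ_[p]) = z := by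
    rcases hj2.eq_or_lt with rfl | hj2
    · obtain ⟨b, hb⟩ := exists_coe_eq_prime_mul_bernoulli (p := p) (by omega) (p - 1)
      obtain ⟨l, hl⟩ := hodd
      refine ⟨b * (l + 1 : ℕ), ?_⟩
      have h : (p - 1 + 2).choose 2 = p * (l + 1) := by
        rw [Nat.choose_two_right, show p - 1 + 2 - 1 = p by omega]
        exact Nat.div_eq_of_eq_mul_left two_pos (by rw [hl]; ring)
      rw [h, show p - 1 + 2 - 2 = p - 1 by omega]
      push_cast [hb]
      ring
    · obtain ⟨c, hc⟩ := exists_bernoulli_eq_mod_prime hp (k := p - 1 + j - 2)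
        ((hodd.add hj).tsub even_two) (by
          rw [show p - 1 + j - 2 = (p - 1) + (j - 2) by omega,
            Nat.dvd_add_right (dvd_refl _)]
          exact hnd _ (by omega) (by omega))
      exact ⟨(p - 1 + j).choose 2 * ((p - 1 + j - 2 : ℕ) * twistedSum p 1 (p - 1 + j - 2)
        + p * c), by rw [hc]; push_cast; rfl⟩
  obtain ⟨c, hc⟩ := exists_dividedBernoulli_eq_mod_prime_sq hp hj (hnd j (by omega) (by omega))
    (Nat.not_dvd_of_pos_of_lt (by omega) (by omega)) hz1
  obtain ⟨d, hd⟩ := exists_dividedBernoulli_eq_mod_prime_sq hp (hodd.add hj)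
    (by rw [Nat.dvd_add_right (dvd_refl _)]; exact hnd _ (by omega) (by omega))
    (fun h => by
      have := Nat.eq_of_dvd_of_lt_two_mul (by omega) h (by omega)
      omega) hz2
  obtain ⟨e, he⟩ := exists_coe_eq_inv (p := p) (m := 2)
    (Nat.not_dvd_of_pos_of_lt (by norm_num) (by omega))
  have hper : ∀ r, twistedSum p r (p - 1 + j) = twistedSum p r j := fun r => by
    rw [add_comm, ← twistedSum_add_card p r j 1, one_mul]
  refine ⟨(p - 1) * e * twistedSum p 2 j - (if j = 2 then e * e else 0) + p * (d - c), ?_, ?_⟩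
  · push_cast at he
    push_cast [hc, hd, hper, he, Nat.cast_sub hpr.one_le]
    rw [if_neg (by omega)]
    split_ifs with h
    · push_cast [he]; ring
    · push_cast; ring
  · have he' : (PadicInt.toZMod e : ZMod p) = 2⁻¹ := by
      apply eq_inv_of_mul_eq_one_left
      have h1 : e * (2 : ℕ) = 1 := by
        apply PadicInt.ext
        rw [PadicInt.coe_mul, PadicInt.coe_natCast, he, PadicInt.coe_one,
          inv_mul_cancel₀ (Nat.cast_ne_zero.mpr two_ne_zero)]
      rw [← Nat.cast_two, ← map_natCast (PadicInt.toZMod : ℤ_[p] →+* ZMod p), ← map_mul, h1,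
        map_one]
    have h4 : (4 : ZMod p) = 2 * 2 := by norm_num
    split_ifs
    · simp [toZMod_twistedSum, he', h4]; ring
    · simp [toZMod_twistedSum, he']; ring

theorem exists_bernoulli_eq_mod_prime_cubed {p : ℕ} [Fact p.Prime] (hp : 7 ≤ p) {k : ℕ}
    (hk : Even k) (hk4 : 4 ≤ k) (hpk : ¬ p - 1 ∣ k) (hpk2 : ¬ p - 1 ∣ k - 2) :
    ∃ c : ℤ_[p], (p : ℚ_[p]) * (bernoulli k : ℚ_[p]) =
      p * k * twistedSum p 1 k + p ^ 2 * (k * (k - 1) / 2) * twistedSum p 2 k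
        + p ^ 3 * (k * (k - 1) * (k - 2) / 6) * (twistedSum p 3 k - twistedSum p 1 (k - 2))
        + p ^ 4 * c := by
  obtain ⟨c, hc⟩ := exists_bernoulli_eq_twistedSum hp hk hpk
  obtain ⟨d, hd⟩ := exists_bernoulli_eq_mod_prime hp (hk.tsub even_two) hpk2
  obtain ⟨d3, hd3⟩ := exists_coe_eq_inv (p := p) (m := 3)
    (Nat.not_dvd_of_pos_of_lt (by norm_num) (by omega))
  have hch : (k.choose 3 : ℚ_[p]) = k * (k - 1) * (k - 2) / 6 := by
    have h := Nat.choose_succ_right_eq k 2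
    have h' := congrArg (Nat.cast : ℕ → ℚ_[p]) h
    push_cast [Nat.cast_choose_two, Nat.cast_sub (by omega : 2 ≤ k)] at h'
    linear_combination h' / 3
  refine ⟨c - k.choose 2 * d * d3, ?_⟩
  rw [if_neg (by omega), hd, hch] at hc
  push_cast at hd3
  push_cast [hd3]
  push_cast [Nat.cast_choose_two, Nat.cast_sub (by omega : 2 ≤ k)] at hc ⊢
  linear_combination hc

theorem toZMod_teichQuot_neg {p : ℕ} [Fact p.Prime] (h2 : p ≠ 2) (u : (ZMod p)ˣ) :
    PadicInt.toZMod (teichQuot (-u)) = PadicInt.toZMod (teichQuot u) - (u : ZMod p)⁻¹ := by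
  rw [teichQuot_neg h2, map_sub, toZMod_teich, Units.val_inv_eq_inv_val]

theorem twistedSumMod_neg {p : ℕ} [Fact p.Prime] (h2 : p ≠ 2) (r k : ℕ) :
    twistedSumMod p r k = ∑ u : (ZMod p)ˣ,
      (-(u : ZMod p)) ^ k * (PadicInt.toZMod (teichQuot u) - (u : ZMod p)⁻¹) ^ r := by
  rw [twistedSumMod, ← Equiv.sum_comp (Equiv.neg _)]
  refine sum_congr rfl fun u _ => ?_
  rw [Equiv.neg_apply, Units.val_neg, toZMod_teichQuot_neg h2]

theorem two_mul_twistedSumMod_one {p : ℕ} [Fact p.Prime] (h2 : p ≠ 2) {k : ℕ} (hk : Odd k) :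
    2 * twistedSumMod p 1 k = twistedSumMod p 0 (k - 1) := by
  obtain ⟨l, rfl⟩ := hk
  rw [two_mul]
  nth_rewrite 2 [twistedSumMod_neg h2]
  rw [twistedSumMod, twistedSumMod, ← sum_add_distrib]
  refine sum_congr rfl fun u _ => ?_
  have hu : (u : ZMod p) ≠ 0 := u.ne_zero
  rw [Odd.neg_pow ⟨l, rfl⟩, Nat.add_sub_cancel, pow_succ]
  field_simp
  ring

theorem two_mul_twistedSumMod_two {p : ℕ} [Fact p.Prime] (h2 : p ≠ 2) {k : ℕ} (hk : Odd k)
    (hk2 : 2 ≤ k) :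
    2 * twistedSumMod p 2 k = 2 * twistedSumMod p 1 (k - 1) - twistedSumMod p 0 (k - 2) := by
  obtain ⟨l, rfl⟩ : ∃ l, k = l + 2 := ⟨k - 2, by omega⟩
  rw [two_mul]
  nth_rewrite 2 [twistedSumMod_neg h2]
  rw [twistedSumMod, twistedSumMod, twistedSumMod, ← sum_add_distrib, mul_sum, ← sum_sub_distrib]
  refine sum_congr rfl fun u _ => ?_
  have hu : (u : ZMod p) ≠ 0 := u.ne_zero
  rw [hk.neg_pow, Nat.add_sub_cancel, show l + 2 - 1 = l + 1 by omega, pow_add, pow_succ _ l]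
  field_simp
  ring

theorem sum_range_twistedSumMod_mul {p : ℕ} [Fact p.Prime] (r s : ℕ) {k : ℕ} (hk : p - 1 ≤ k) :
    ∑ i ∈ range (p - 1), twistedSumMod p r i * twistedSumMod p s (k - i)
      = -twistedSumMod p (r + s) k := by
  have hgeom : ∀ u w : (ZMod p)ˣ, ∑ i ∈ range (p - 1), (u : ZMod p) ^ i * (w : ZMod p) ^ (k - i)
      = if u = w then -(u : ZMod p) ^ k else 0 := by
    intro u w
    split_ifs with h
    · subst h
      rw [sum_congr rfl fun i hi => by
        rw [← pow_add, Nat.add_sub_cancel' ((mem_range.mp hi).le.trans hk)]]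
      simp [Nat.cast_sub (Fact.out : p.Prime).one_le]
    · have h1 : (∑ i ∈ range (p - 1), (u : ZMod p) ^ i * (w : ZMod p) ^ (p - 1 - 1 - i))
          * ((u : ZMod p) - w) = 0 := by
        rw [(Commute.all _ _).geom_sum₂_mul, ZMod.pow_card_sub_one_eq_one u.ne_zero,
          ZMod.pow_card_sub_one_eq_one w.ne_zero, sub_self]
      have h2 := (mul_eq_zero.mp h1).resolve_right (sub_ne_zero.mpr fun h3 => h (Units.ext h3))
      rw [← zero_mul ((w : ZMod p) ^ (k - (p - 1 - 1))), ← h2, sum_mul]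
      refine sum_congr rfl fun i hi => ?_
      have := mem_range.mp hi
      rw [mul_assoc, ← pow_add]
      congr 2
      omega
  calc ∑ i ∈ range (p - 1), twistedSumMod p r i * twistedSumMod p s (k - i)
      = ∑ u : (ZMod p)ˣ, ∑ w : (ZMod p)ˣ,
          (PadicInt.toZMod (teichQuot u) ^ r * PadicInt.toZMod (teichQuot w) ^ s) *
          ∑ i ∈ range (p - 1), (u : ZMod p) ^ i * (w : ZMod p) ^ (k - i) := by
        simp only [twistedSumMod, sum_mul_sum]
        rw [sum_comm]
        refine sum_congr rfl fun u _ => ?_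
        rw [sum_comm]
        refine sum_congr rfl fun w _ => ?_
        rw [mul_sum]
        refine sum_congr rfl fun i _ => ?_
        ring
    _ = _ := by
        simp only [hgeom, mul_ite, mul_zero, sum_ite_eq, mem_univ, if_true]
        rw [twistedSumMod, ← sum_neg_distrib]
        refine sum_congr rfl fun u _ => ?_
        ring

theorem twistedSumMod_one_one {p : ℕ} [Fact p.Prime] (h2 : p ≠ 2) :
    2 * twistedSumMod p 1 1 = -1 := by
  rw [two_mul_twistedSumMod_one h2 odd_one, Nat.sub_self, twistedSumMod_zero_zero]

theorem twistedSumMod_one_odd {p : ℕ} [Fact p.Prime] (h2 : p ≠ 2) {k : ℕ} (hk : Odd k)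
    (hpk : ¬ p - 1 ∣ k - 1) : twistedSumMod p 1 k = 0 := by
  have h := two_mul_twistedSumMod_one h2 hk
  rw [twistedSumMod_zero_left p hpk] at h
  exact (mul_eq_zero.mp h).resolve_left (ZMod.two_ne_zero_of_prime h2)

theorem exists_prod_one_add_mul_eq {ι R : Type*} [CommRing R] (s : Finset ι) (x : R)
    (f : ι → R) : ∃ c, ∏ i ∈ s, (1 + x * f i) = 1 + x * ∑ i ∈ s, f i + x ^ 2 * c := by
  classical
  induction s using Finset.induction_on with
  | empty => exact ⟨0, by simp⟩
  | insert a s ha ih =>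
    obtain ⟨c, hc⟩ := ih
    refine ⟨c * (1 + x * f a) + f a * ∑ i ∈ s, f i, ?_⟩
    rw [prod_insert ha, sum_insert ha, hc]
    ring

theorem hasReduction_wilsonQuotient {p : ℕ} [Fact p.Prime] (h2 : p ≠ 2) :
    HasReduction p (wilsonQuotient p) (-twistedSumMod p 1 0) := by
  have hpr : p.Prime := Fact.out
  obtain ⟨c, hc⟩ := exists_prod_one_add_mul_eq (univ : Finset (ZMod p)ˣ) (p : ℤ_[p]) teichQuot
  have hfac : ((Nat.factorial (p - 1) : ℕ) : ℤ_[p])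
      = -(1 + p * twistedSum p 1 0 + p ^ 2 * c) := by
    have h1 : ∏ u : (ZMod p)ˣ, teich p u = -1 := by
      rw [← map_prod, ← teich_neg_one h2]
      have h := congrArg (Units.val) (FiniteField.prod_univ_units_id_eq_neg_one (K := ZMod p))
      rw [Units.coe_prod, Units.val_neg, Units.val_one] at h
      rw [h]
    have h3 := prod_Ico_id_eq_factorial (p - 1)
    rw [Nat.sub_add_cancel hpr.one_le] at h3
    rw [← h3, Nat.cast_prod, ← prod_zmod_val_eq (fun a => (a : ℤ_[p]))]
    simp only [val_eq_teich_mul, prod_mul_distrib, h1, hc, twistedSum, pow_zero, pow_one, one_mul]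
    ring
  have hfac' := congrArg (fun t : ℤ_[p] => (t : ℚ_[p])) hfac
  push_cast at hfac'
  have hp0 : (p : ℚ_[p]) ≠ 0 := by exact_mod_cast hpr.ne_zero
  refine ⟨-(twistedSum p 1 0 + p * c), ?_, ?_⟩
  · rw [wilsonQuotient]
    push_cast [hfac']
    field_simp
    ring
  · simp [toZMod_twistedSum]

theorem hasReduction_bernoulliCombination {p n : ℕ} [Fact p.Prime] (hp : 11 ≤ p)
    (hn : 4 ≤ 2 * n) (hnp : 2 * n ≤ p - 7) :
    HasReduction p (bernoulliCombination p n)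
      (-(twistedSumMod p 3 (p - 1 - 2 * n) - twistedSumMod p 1 (p - 1 - 2 * n - 2)) * 2⁻¹) := by
  have hpr : p.Prime := Fact.out
  have hpe : Even (p - 1) := hpr.even_sub_one (by omega)
  obtain ⟨m, hm⟩ : ∃ m, m = p - 1 - 2 * n := ⟨_, rfl⟩
  have hme : Even m := by rw [hm]; exact hpe.tsub (even_two_mul n)
  have hndvd : ∀ i t, 0 < i → i < p - 1 → ¬ p - 1 ∣ i + t * (p - 1) := fun i t h0 h1 h =>
    Nat.not_dvd_of_pos_of_lt h0 h1 ((Nat.dvd_add_left (dvd_mul_left _ _)).mp h)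
  have key : ∀ t : ℕ, ∃ c : ℤ_[p], (p : ℚ_[p]) * (bernoulli (m + t * (p - 1)) : ℚ_[p]) =
      p * (m + t * (p - 1)) * twistedSum p 1 m
        + p ^ 2 * ((m + t * (p - 1)) * (m + t * (p - 1) - 1) / 2) * twistedSum p 2 m
        + p ^ 3 * ((m + t * (p - 1)) * (m + t * (p - 1) - 1) * (m + t * (p - 1) - 2) / 6)
          * (twistedSum p 3 m - twistedSum p 1 (m - 2)) + p ^ 4 * c := by
    intro t
    have e : m + t * (p - 1) - 2 = m - 2 + t * (p - 1) := by omega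
    obtain ⟨c, hc⟩ := exists_bernoulli_eq_mod_prime_cubed (p := p) (by omega)
      (k := m + t * (p - 1)) (hme.add (hpe.mul_left t)) (by omega)
      (hndvd m t (by omega) (by omega)) (by rw [e]; exact hndvd _ t (by omega) (by omega))
    refine ⟨c, ?_⟩
    rw [hc, e]
    simp only [twistedSum_add_card]
    push_cast [Nat.cast_sub hpr.one_le]
    ring
  obtain ⟨c0, h0⟩ := key 0
  obtain ⟨c1, h1⟩ := key 1
  obtain ⟨c2, h2⟩ := key 2
  obtain ⟨c3, h3⟩ := key 3
  obtain ⟨d, hd, hd'⟩ := HasReduction.inv_natCast (p := p) (m := 2)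
    (Nat.not_dvd_of_pos_of_lt (by norm_num) (by omega))
  have hp0 : (p : ℚ_[p]) ≠ 0 := by exact_mod_cast hpr.ne_zero
  push_cast at hd hd'
  refine ⟨((p - 1) ^ 3 * (twistedSum p 3 m - twistedSum p 1 (m - 2))
    + p * (c3 - 3 * c2 + 3 * c1 - c0)) * d, ?_, ?_⟩
  · rw [bernoulliCombination, show 4 * (p - 1) - 2 * n = m + 3 * (p - 1) by omega,
      show 3 * (p - 1) - 2 * n = m + 2 * (p - 1) by omega,
      show 2 * (p - 1) - 2 * n = m + 1 * (p - 1) by omega,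
      show p - 1 - 2 * n = m + 0 * (p - 1) by omega]
    have h3' : (((3 : ℤ_[p])) : ℚ_[p]) = 3 := by exact_mod_cast PadicInt.coe_natCast 3
    push_cast [hd, h3'] at h0 h1 h2 h3 ⊢
    rw [h0, mul_assoc 3, mul_assoc 3, h1, h2, h3]
    field_simp
    ring
  · rw [← hm]
    simp only [map_mul, map_add, map_sub, map_pow, map_natCast, map_one, ZMod.natCast_self,
      toZMod_twistedSum, hd', zero_mul]
    ring

theorem dividedBernoulli_odd {k : ℕ} (hk : Odd k) (hk2 : 2 ≤ k) : dividedBernoulli k = 0 := by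
  rw [dividedBernoulli, bernoulli_eq_zero_of_odd hk (by omega), zero_div]

theorem hasReduction_dividedBernoulli_of_lt {p : ℕ} [Fact p.Prime] (hp : 7 ≤ p) {k : ℕ}
    (hk2 : 2 ≤ k) (hkp : k ≤ p - 2) :
    HasReduction p (dividedBernoulli k) (twistedSumMod p 1 k) := by
  rcases Nat.even_or_odd k with hk | hk
  · exact hasReduction_dividedBernoulli hp hk
      (Nat.not_dvd_of_pos_of_lt (by omega) (by omega))
      (Nat.not_dvd_of_pos_of_lt (by omega) (by omega))
  · rw [dividedBernoulli_odd hk hk2, twistedSumMod_one_odd (by omega) hk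
      (Nat.not_dvd_of_pos_of_lt (by omega) (by omega))]
    simpa using HasReduction.natCast (p := p) 0

theorem hasReduction_residueD {p : ℕ} [Fact p.Prime] (hp : 7 ≤ p) {j : ℕ} (hj : Even j)
    (hj2 : 2 ≤ j) (hjp : j ≤ p - 3) :
    HasReduction p (residueD p j) (-twistedSumMod p 2 j / 2 - if j = 2 then 1 / 4 else 0) := by
  obtain ⟨z, hz, hz'⟩ := exists_dividedBernoulli_sub_eq hp hj hj2 hjp
  rw [← hz']
  exact hasReduction_residue_one hz

theorem hasReduction_dividedBernoulli_mul_residueD {p : ℕ} [Fact p.Prime] (hp : 7 ≤ p)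
    {i j : ℕ} (hij : Even (i + j)) (hi2 : 2 ≤ i) (hip : i ≤ p - 3) (hj2 : 2 ≤ j)
    (hjp : j ≤ p - 3) :
    HasReduction p (dividedBernoulli i * (residueD p j : ℚ))
      (twistedSumMod p 1 i * (-twistedSumMod p 2 j / 2 - if j = 2 then 1 / 4 else 0)) := by
  rcases Nat.even_or_odd i with hi | hi
  · exact (hasReduction_dividedBernoulli_of_lt hp hi2 (by omega)).mul
      (hasReduction_residueD hp ((Nat.even_add.mp hij).mp hi) hj2 hjp)
  · rw [dividedBernoulli_odd hi hi2, zero_mul, twistedSumMod_one_odd (by omega) hi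
      (Nat.not_dvd_of_pos_of_lt (by omega) (by omega)), zero_mul]
    simpa using HasReduction.natCast (p := p) 0

theorem pIntegral_dividedBernoulli_sub {p : ℕ} [Fact p.Prime] (hp : 7 ≤ p) {i : ℕ}
    (hi2 : 2 ≤ i) (hip : i ≤ p - 3) :
    PIntegral p (dividedBernoulli (p - 1 + i) - dividedBernoulli i) := by
  rcases Nat.even_or_odd i with hi | hi
  · obtain ⟨z, hz, -⟩ := exists_dividedBernoulli_sub_eq hp hi hi2 hip
    exact pIntegral_iff_exists.mpr ⟨p * z, by rw [hz]; push_cast; rfl⟩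
  · have hpe : Even (p - 1) := (Fact.out : p.Prime).even_sub_one (by omega)
    rw [dividedBernoulli_odd hi hi2, dividedBernoulli_odd (hpe.add_odd hi) (by omega), sub_zero]
    simpa using (HasReduction.natCast (p := p) 0).pIntegral

theorem hasReduction_convB {p : ℕ} [Fact p.Prime] (hp : 7 ≤ p) :
    HasReduction p (convB (p - 1)) (-twistedSumMod p 2 0 - twistedSumMod p 1 0 ^ 2) := by
  have hpe : Even (p - 1) := (Fact.out : p.Prime).even_sub_one (by omega)
  have h : HasReduction p (convB (p - 1))
      (∑ i ∈ Ico 2 (p - 2), twistedSumMod p 1 i * twistedSumMod p 1 (p - 1 - i)) := by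
    have he : Icc 2 (p - 1 - 2) = Ico 2 (p - 2) := by ext; simp; omega
    rw [convB, he]
    refine HasReduction.sum fun i hi => ?_
    rw [mem_Ico] at hi
    exact (hasReduction_dividedBernoulli_of_lt hp (by omega) (by omega)).mul
      (hasReduction_dividedBernoulli_of_lt hp (by omega) (by omega))
  have hodd : twistedSumMod p 1 (p - 2) = 0 := by
    refine twistedSumMod_one_odd (by omega) ?_ (Nat.not_dvd_of_pos_of_lt (by omega) (by omega))
    have := Nat.Even.sub_odd (by omega) hpe odd_one
    rwa [Nat.sub_sub] at this
  have hsum := sum_range_twistedSumMod_mul (p := p) 1 1 (le_refl (p - 1))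
  have hz := twistedSumMod_add_card p
  rw [range_eq_Ico, sum_eq_sum_Ico_succ_bot (by omega), sum_eq_sum_Ico_succ_bot (by omega),
    show p - 1 = p - 2 + 1 by omega, sum_Ico_succ_top (by omega),
    show p - 2 + 1 = p - 1 by omega, hodd, show p - 1 - (0 + 1) = p - 2 by omega, hodd,
    Nat.sub_zero] at hsum
  have hz1 := hz 1 0
  have hz2 := hz 2 0
  rw [zero_add] at hz1 hz2
  rw [hz1, hz2, zero_mul, mul_zero, add_zero, zero_add] at hsum
  convert h using 1
  linear_combination -hsum

theorem corollary4 (p : ℕ) [Fact p.Prime] (hp : 11 ≤ p) (n : ℕ)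
    (hn : 4 ≤ 2 * n) (hnp : 2 * n ≤ p - 7) :
    -- all the `p`-adic integers that occur are indeed `p`-integral
    ((∀ i ∈ Finset.Icc 2 (p - 3), PIntegral p (dividedBernoulli i) ∧
        PIntegral p (dividedBernoulli (p - 1 + i) - dividedBernoulli i)) ∧
      PIntegral p (wilsonQuotient p) ∧
      PIntegral p (bernoulliCombination p n)) ∧
    -- the congruence modulo `p`
    CongrModP p
      (truncConvBD p (p + 1 - 2 * n) (p - 3))
      (-convBD p (p - 1 - 2 * n)
        + wilsonQuotient p *
          (residue p (dividedBernoulli (2 * (p - 1) - 2 * n)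
            - dividedBernoulli (p - 1 - 2 * n)) 1 : ℚ)
        - 1 / 2 * (wilsonQuotient p ^ 2 + convB (p - 1)) * dividedBernoulli (p - 1 - 2 * n)
        - bernoulliCombination p n) := by
  have h2p : p ≠ 2 := by omega
  have hp7 : 7 ≤ p := by omega
  have hw := hasReduction_wilsonQuotient h2p
  have hcomb := hasReduction_bernoulliCombination hp hn hnp
  refine ⟨⟨fun i hi => ?_, hw.pIntegral, hcomb.pIntegral⟩, ?_⟩
  · rw [mem_Icc] at hi
    exact ⟨(hasReduction_dividedBernoulli_of_lt hp7 hi.1 (by omega)).pIntegral,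
      pIntegral_dividedBernoulli_sub hp7 hi.1 hi.2⟩
  have hpe : Even (p - 1) := (Fact.out : p.Prime).even_sub_one (by omega)
  obtain ⟨m, hm⟩ : ∃ m, m = p - 1 - 2 * n := ⟨_, rfl⟩
  have hme : Even m := by rw [hm]; exact hpe.tsub (even_two_mul n)
  have hV := twistedSumMod_add_card p
  have h2 := ZMod.two_ne_zero_of_prime h2p
  have hnd : ∀ i, 0 < i → i < p - 1 → ¬ p - 1 ∣ i := fun i => Nat.not_dvd_of_pos_of_lt
  rw [show p + 1 - 2 * n = m + 2 by omega, show 2 * (p - 1) - 2 * n = p - 1 + m by omega, ← hm]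
  rw [← hm] at hcomb
  obtain ⟨K, hK⟩ : ∃ K, K = m + (p - 1) := ⟨_, rfl⟩
  have hT : HasReduction p (truncConvBD p (m + 2) (p - 3))
      (∑ i ∈ Ico (m + 2) (p - 2), twistedSumMod p 1 i * (-twistedSumMod p 2 (K - i) / 2)) := by
    have he : Icc (m + 2) (p - 3) = Ico (m + 2) (p - 2) := by ext; simp; omega
    rw [truncConvBD, he]
    refine HasReduction.sum fun i hi => ?_
    rw [mem_Ico] at hi
    have h := hasReduction_dividedBernoulli_mul_residueD hp7 (i := i) (j := K - i)
      (by rw [Nat.add_sub_cancel' (by omega), hK]; exact hme.add hpe) (by omega) (by omega)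
      (by omega) (by omega)
    rw [if_neg (by omega), sub_zero] at h
    rwa [show m + 2 + (p - 3) - i = K - i by omega]
  have hC : HasReduction p (convBD p m)
      (∑ i ∈ Ico 2 (m - 1), twistedSumMod p 1 i * (-twistedSumMod p 2 (K - i) / 2)
        - twistedSumMod p 1 (m - 2) * (1 / 4)) := by
    have he : Icc 2 (m - 2) = Ico 2 (m - 1) := by ext; simp; omega
    have hs : ∑ i ∈ Ico 2 (m - 1), twistedSumMod p 1 i * (-twistedSumMod p 2 (K - i) / 2)
        - twistedSumMod p 1 (m - 2) * (1 / 4) = ∑ i ∈ Ico 2 (m - 1), twistedSumMod p 1 i *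
          (-twistedSumMod p 2 (m - i) / 2 - if m - i = 2 then 1 / 4 else 0) := by
      simp only [mul_sub, sum_sub_distrib]
      congr 1
      · refine sum_congr rfl fun i hi => ?_
        rw [mem_Ico] at hi
        rw [show K - i = m - i + (p - 1) by omega, hV]
      · rw [sum_eq_single_of_mem (m - 2) (by rw [mem_Ico]; omega), if_pos (by omega)]
        intro i hi hne
        rw [mem_Ico] at hi
        rw [if_neg (by omega), mul_zero]
    rw [convBD, he, hs]
    refine HasReduction.sum fun i hi => ?_
    rw [mem_Ico] at hi
    exact hasReduction_dividedBernoulli_mul_residueD hp7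
      (by rw [Nat.add_sub_cancel' (by omega)]; exact hme) (by omega) (by omega)
      (by omega) (by omega)
  have hD := hasReduction_residueD hp7 hme (by omega) (by omega)
  rw [residueD, if_neg (by omega), sub_zero] at hD
  have hB := hasReduction_dividedBernoulli_of_lt hp7 (k := m) (by omega) (by omega)
  have hhalf := HasReduction.inv_natCast (p := p) (m := 2)
    (Nat.not_dvd_of_pos_of_lt (by norm_num) (by omega))
  have hR := (((hC.neg.add (hw.mul hD)).sub ((hhalf.mul
    ((hw.mul hw).add (hasReduction_convB hp7))).mul hB)).sub hcomb)
  rw [pow_two, one_div]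
  rw [Nat.cast_two] at hR
  refine hT.congrModP ?_
  convert hR using 1
  have hodd : ∀ i, Odd i → 2 ≤ i → i < p - 1 → twistedSumMod p 1 i = 0 := fun i hi h2i hip =>
    twistedSumMod_one_odd h2p hi (hnd _ (by omega) (by omega))
  have ho1 : twistedSumMod p 1 (m - 1) = 0 :=
    hodd _ (Nat.Even.sub_odd (by omega) hme odd_one) (by omega) (by omega)
  have ho2 : twistedSumMod p 1 (m + 1) = 0 := hodd _ hme.add_one (by omega) (by omega)
  have ho3 : twistedSumMod p 1 (p - 2) = 0 := by
    refine hodd _ ?_ (by omega) (by omega)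
    have := Nat.Even.sub_odd (by omega) hpe odd_one
    rwa [Nat.sub_sub] at this
  have h11 := twistedSumMod_one_one h2p
  have h21 : twistedSumMod p 2 (K - 1) = twistedSumMod p 1 (m - 2) := by
    have h := two_mul_twistedSumMod_two h2p (k := K - 1)
      (Nat.Even.sub_odd (by omega) (hK ▸ hme.add hpe) odd_one) (by omega)
    rw [show K - 1 - 1 = m - 2 + (p - 1) by omega, hV,
      show K - 1 - 2 = m - 3 + (p - 1) by omega, hV,
      twistedSumMod_zero_left p (hnd (m - 3) (by omega) (by omega)), sub_zero] at h
    exact mul_left_cancel₀ h2 h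
  have hsum := sum_range_twistedSumMod_mul (p := p) 1 2 (k := K) (by omega)
  rw [range_eq_Ico, sum_eq_sum_Ico_succ_bot (by omega), sum_eq_sum_Ico_succ_bot (by omega),
    ← sum_Ico_consecutive _ (by omega : 0 + 1 + 1 ≤ m - 1) (by omega : m - 1 ≤ p - 1),
    sum_eq_sum_Ico_succ_bot (by omega : m - 1 < p - 1), show m - 1 + 1 = m by omega,
    sum_eq_sum_Ico_succ_bot (by omega : m < p - 1),
    sum_eq_sum_Ico_succ_bot (by omega : m + 1 < p - 1),
    show p - 1 = p - 2 + 1 by omega, sum_Ico_succ_top (by omega), ho1, ho2, ho3,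
    zero_add, h21, Nat.sub_zero, show K - m = 0 + (p - 1) by omega, hV] at hsum
  have hK2 : twistedSumMod p 2 K = twistedSumMod p 2 m := by rw [hK, hV]
  have hK3 : twistedSumMod p (1 + 2) K = twistedSumMod p 3 m := by rw [hK, hV]
  rw [hK2, hK3] at hsum
  have hi : (2 : ZMod p) * 2⁻¹ = 1 := mul_inv_cancel₀ h2
  have h11' : twistedSumMod p 1 1 = -2⁻¹ := by
    linear_combination 2⁻¹ * h11 - twistedSumMod p 1 1 * hi
  have h4 : (1 : ZMod p) / 4 = 2⁻¹ * 2⁻¹ := by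
    rw [show (4 : ZMod p) = 2 * 2 by norm_num, one_div, mul_inv]
  have hdiv : ∀ s : Finset ℕ, ∑ i ∈ s, twistedSumMod p 1 i * (-twistedSumMod p 2 (K - i) / 2)
      = -2⁻¹ * ∑ i ∈ s, twistedSumMod p 1 i * twistedSumMod p 2 (K - i) := fun s => by
    rw [mul_sum]
    exact sum_congr rfl fun i _ => by ring
  rw [hdiv, hdiv, h4]
  push_cast
  rw [div_eq_mul_inv]
  linear_combination (-2⁻¹ : ZMod p) * hsum + 2⁻¹ * twistedSumMod p 1 (m - 2) * h11'
    - 2⁻¹ * twistedSumMod p 1 (m - 2) * hi
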